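/- Let $X, X_1, X_2, \dots$ be independent, identically distributed real random variables with law $G$, let $k\ge 2$ be an integer, and suppose $\mathbb{E}|X|^{4k}<\infty$ and $\sigma^2:=\mathrm{Var}(X)>0$ (with $\sigma>0$). For $2\le p\le k$ let $f_p,g_p:\mathbb{R}\to\mathbb{R}$ be functions of class $C^1$. For $\ell\ge 0$ put $m_\ell=\mathbb{E}(X^\ell)$, $m=m_1$, $\mu_\ell=\mathbb{E}\big((X-m)^\ell\big)$, and for $n\ge 1$ put $\overline X=\frac1n\sum_{i=1}^n X_i$ and $\mu_{n,\ell}=\frac1n\sum_{i=1}^n (X_i-\overline X)^\ell$. For $p\ge 2$ let $$b_{n,p}=\frac{\mu_{n,2p-1}}{\mu_{n,2}^{(2p-1)/2}},\qquad a_{n,p}=\frac{\mu_{n,2p}}{\mu_{n,2}^{p}},\qquad b_p=\frac{\mu_{2p-1}}{\sigma^{2p-1}},\qquad a_p=\frac{\mu_{2p}}{\sigma^{2p}},$$ where a quotient with denominator $0$ is read as $0$ (an event whose probability tends to $0$), and $$T_n(f,g,k)=\sum_{p=2}^k\big(f_p(b_{n,p})+g_p(a_{n,p})\big),\qquad T(f,g,k)=\sum_{p=2}^k\big(f_p(b_p)+g_p(a_p)\big).$$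 With $h_\ell(x)=x^\ell$, define the polynomials $$A(\ell)=h_\ell+\sum_{p=0}^{\ell-1}\binom{\ell}{p}(-1)^{\ell-p}\Big(m^{\ell-p}h_p+(\ell-p)\,m^{\ell-p-1}m_p\,h_1\Big),$$ $$B(p)=\sigma^{-(2p-1)}\Big(A(2p-1)-\tfrac12(2p-1)\sigma^{-2}\mu_{2p-1}A(2)\Big),\qquad C(p)=\sigma^{-2p}\Big(A(2p)-p\,\sigma^{-2}\mu_{2p}A(2)\Big),$$ $$D_k=\sum_{p=2}^k\big(f_p'(b_p)B(p)+g_p'(a_p)C(p)\big).$$ Then $D_k$ and $D_k^2$ are $G$-integrable and, as $n\to\infty$, $$\sqrt n\,\big(T_n(f,g,k)-T(f,g,k)\big)\ \longrightarrow\ \mathcal N(0,\sigma_k^2)\quad\text{in distribution},$$ where $$\sigma_k^2=\int D_k^2\,dG-\Big(\int D_k\,dG\Big)^2=\mathrm{Var}(D_k(X)),$$ and $\mathcal N(0,0)$ denotes the point mass at $0$. -/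

import Mathlib

open MeasureTheory ProbabilityTheory Filter Topology
open scoped NNReal

namespace NCEM

noncomputable section

/-- The empirical mean of the first `n` terms of the sequence `x`. -/
def empMean (x : ℕ → ℝ) (n : ℕ) : ℝ :=
  (1 / (n : ℝ)) * ∑ i ∈ Finset.range n, x i

/-- The centered empirical moment of order `l` of the first `n` terms of `x`. -/
def empCentralMoment (x : ℕ → ℝ) (n l : ℕ) : ℝ :=
  (1 / (n : ℝ)) * ∑ i ∈ Finset.range n, (x i - empMean x n) ^ l

/-- The normalized centered empirical moment of odd order `2 p - 1`. -/
def bEmp (x : ℕ → ℝ) (n p : ℕ) : ℝ :=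
  empCentralMoment x n (2 * p - 1) / (empCentralMoment x n 2) ^ ((2 * (p : ℝ) - 1) / 2)

/-- The normalized centered empirical moment of even order `2 p`. -/
def aEmp (x : ℕ → ℝ) (n p : ℕ) : ℝ :=
  empCentralMoment x n (2 * p) / (empCentralMoment x n 2) ^ p

/-- The statistic `T_n(f, g, k)`. -/
def TEmp (f g : ℕ → ℝ → ℝ) (k : ℕ) (x : ℕ → ℝ) (n : ℕ) : ℝ :=
  ∑ p ∈ Finset.Icc 2 k, (f p (bEmp x n p) + g p (aEmp x n p))

/-- The standard deviation of the law `G`. -/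
def sigma (G : Measure ℝ) : ℝ := √(Var[id; G])

/-- The normalized centered moment of odd order `2 p - 1` of the law `G`. -/
def bTh (G : Measure ℝ) (p : ℕ) : ℝ :=
  centralMoment id (2 * p - 1) G / sigma G ^ (2 * p - 1)

/-- The normalized centered moment of even order `2 p` of the law `G`. -/
def aTh (G : Measure ℝ) (p : ℕ) : ℝ :=
  centralMoment id (2 * p) G / sigma G ^ (2 * p)

/-- The limit value `T(f, g, k)`. -/
def TTh (f g : ℕ → ℝ → ℝ) (k : ℕ) (G : Measure ℝ) : ℝ :=
  ∑ p ∈ Finset.Icc 2 k, (f p (bTh G p) + g p (aTh G p))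

/-- The polynomial function `A(l)`. -/
def APoly (G : Measure ℝ) (l : ℕ) (x : ℝ) : ℝ :=
  x ^ l + ∑ p ∈ Finset.range l, (l.choose p : ℝ) * (-1) ^ (l - p) *
    (moment id 1 G ^ (l - p) * x ^ p
      + ((l - p : ℕ) : ℝ) * moment id 1 G ^ (l - p - 1) * moment id p G * x)

/-- The polynomial function `B(p)`. -/
def BPoly (G : Measure ℝ) (p : ℕ) (x : ℝ) : ℝ :=
  (sigma G ^ (2 * p - 1))⁻¹ * (APoly G (2 * p - 1) x
    - (1 / 2) * (2 * (p : ℝ) - 1) * (sigma G ^ 2)⁻¹ * centralMoment id (2 * p - 1) G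
      * APoly G 2 x)

/-- The polynomial function `C(p)`. -/
def CPoly (G : Measure ℝ) (p : ℕ) (x : ℝ) : ℝ :=
  (sigma G ^ (2 * p))⁻¹ * (APoly G (2 * p) x
    - (p : ℝ) * (sigma G ^ 2)⁻¹ * centralMoment id (2 * p) G * APoly G 2 x)

/-- The polynomial function `D_k`. -/
def DPoly (f g : ℕ → ℝ → ℝ) (k : ℕ) (G : Measure ℝ) (x : ℝ) : ℝ :=
  ∑ p ∈ Finset.Icc 2 k,
    (deriv (f p) (bTh G p) * BPoly G p x + deriv (g p) (aTh G p) * CPoly G p x)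

end

end NCEM

/-!
This is the delta method, in a form that produces no remainder terms. Each statistic `Y n` built
from the sample has an exact expansion
`Y n - θ = ∑_{j ≤ d} W j n * (M j n - m j)`, with `M j n` the empirical and `m j` the theoretical
moment of order `j`, where the random coefficients `W j n` converge almost surely to constants
`w j`. The class of such statistics (`MomentLinear`) contains the empirical moments by the strong
law of large numbers. It is stable under sums and products, and under composition with a function
differentiable at `θ`, since `F y - F θ` is `y - θ` times a slope continuous at `θ`. The polynomial
`φ x = ∑_{j ≤ d} w j * x ^ j` follows the rules of differentiation. The binomial formula
writes central moments in terms of moments and gives `φ = A(l)`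
(`momentLinear_empCentralMoment`). The quotient rule then gives `B(p)` and `C(p)`
(`momentLinear_bEmp`, `momentLinear_aEmp`), and the chain rule gives `D_k` (`momentLinear_TEmp`).

Multiplying the expansion by `√n` and replacing each `W j n` by `w j` gives
`(√n)⁻¹ * ∑_{i < n} (φ (X i) - E φ)`, which converges in distribution to a centred normal law of
variance `Var φ` by the central limit theorem. The replacement costs
`∑_j (W j n - w j) * √n * (M j n - m j)`. By Chebyshev's inequality `√n * (M j n - m j)` is bounded
in probability, as `X ^ j` is square integrable for `j ≤ 2 k`; so the cost tends to `0` in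
probability (`tendstoInMeasure_mul_normSum`), and Slutsky's theorem concludes
(`MomentLinear.tendstoInDistribution`).
-/

/-! ### Products with a normalized sum -/

namespace NCEM

variable {Ω : Type*} [MeasurableSpace Ω] {P : Measure Ω}

/-- The centred sum `∑_{i < n} (Z i - E (Z 0))` divided by `√n` (and `0` for `n = 0`). -/
noncomputable def normSum (P : Measure Ω) (Z : ℕ → Ω → ℝ) (n : ℕ) (ω : Ω) : ℝ :=
  (√(n : ℝ))⁻¹ * (∑ i ∈ Finset.range n, Z i ω - n * P[Z 0])

lemma memLp_normSum [IsProbabilityMeasure P] {Z : ℕ → Ω → ℝ} (hL : ∀ i, MemLp (Z i) 2 P) (n : ℕ) :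
    MemLp (normSum P Z n) 2 P :=
  ((memLp_finsetSum _ fun i _ ↦ hL i).sub (memLp_const _)).const_mul _

lemma integral_normSum [IsProbabilityMeasure P] {Z : ℕ → Ω → ℝ} (hL : ∀ i, MemLp (Z i) 2 P)
    (hident : ∀ i, IdentDistrib (Z i) (Z 0) P P) (n : ℕ) : P[normSum P Z n] = 0 := by
  have hI : ∀ i, Integrable (Z i) P := fun i ↦ (hL i).integrable one_le_two
  simp only [normSum]
  rw [integral_const_mul, integral_sub (integrable_finsetSum _ fun i _ ↦ hI i)
    (integrable_const _), integral_finsetSum _ fun i _ ↦ hI i,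
    Finset.sum_congr rfl fun i _ ↦ (hident i).integral_eq]
  simp

lemma variance_normSum_le [IsProbabilityMeasure P] {Z : ℕ → Ω → ℝ} (hL : ∀ i, MemLp (Z i) 2 P)
    (hindep : iIndepFun Z P) (hident : ∀ i, IdentDistrib (Z i) (Z 0) P P) (n : ℕ) :
    Var[normSum P Z n; P] ≤ Var[Z 0; P] := by
  have hsum : Var[∑ i ∈ Finset.range n, Z i; P] = n * Var[Z 0; P] := by
    rw [IndepFun.variance_sum (fun i _ ↦ hL i) fun i _ j _ hij ↦ hindep.indepFun hij,
      Finset.sum_congr rfl fun i _ ↦ (hident i).variance_eq]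
    simp
  have h : normSum P Z n = fun ω ↦ (√(n : ℝ))⁻¹ *
      ((∑ i ∈ Finset.range n, Z i) ω - n * P[Z 0]) := by
    ext ω
    simp [normSum]
  rw [h, variance_const_mul, variance_sub_const
    (memLp_finsetSum' _ fun i _ ↦ hL i).aestronglyMeasurable, hsum, inv_pow,
    Real.sq_sqrt n.cast_nonneg, ← mul_assoc]
  exact mul_le_of_le_one_left (variance_nonneg _ _) (inv_mul_le_one)

/-- By Chebyshev's inequality the normalized sums are bounded in probability, so multiplying them
by a sequence that tends to `0` gives a sequence that tends to `0` in probability. -/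
lemma tendstoInMeasure_mul_normSum [IsProbabilityMeasure P] {Z V : ℕ → Ω → ℝ}
    (hL : ∀ i, MemLp (Z i) 2 P) (hindep : iIndepFun Z P)
    (hident : ∀ i, IdentDistrib (Z i) (Z 0) P P) (hV : ∀ n, AEMeasurable (V n) P)
    (hlim : ∀ᵐ ω ∂P, Tendsto (fun n ↦ V n ω) atTop (𝓝 0)) :
    TendstoInMeasure P (fun n ω ↦ V n ω * normSum P Z n ω) atTop (fun _ ↦ 0) := by
  have hVm : TendstoInMeasure P V atTop (fun _ ↦ 0) :=
    tendstoInMeasure_of_tendsto_ae (fun n ↦ (hV n).aestronglyMeasurable) hlim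
  rw [tendstoInMeasure_iff_norm] at hVm ⊢
  intro ε hε
  rw [ENNReal.tendsto_nhds_zero]
  intro δ hδ
  -- choose `M` with `Var (Z 0) / M² ≤ δ / 2`
  obtain ⟨M, hM, hMδ⟩ : ∃ M : ℝ, 0 < M ∧ ENNReal.ofReal (Var[Z 0; P] / M ^ 2) ≤ δ / 2 := by
    have h1 : Tendsto (fun M : ℝ ↦ ENNReal.ofReal (Var[Z 0; P] / M ^ 2)) atTop (𝓝 0) := by
      rw [← ENNReal.ofReal_zero]
      exact ENNReal.tendsto_ofReal
        (tendsto_const_nhds.div_atTop (tendsto_pow_atTop (by norm_num)))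
    have h2 := (ENNReal.tendsto_nhds_zero.1 h1) (δ / 2) (ENNReal.half_pos hδ.ne')
    obtain ⟨M, h, h'⟩ := ((eventually_gt_atTop 0).and h2).exists
    exact ⟨M, h, h'⟩
  filter_upwards [(ENNReal.tendsto_nhds_zero.1 (hVm (ε / M) (by positivity))) (δ / 2)
    (ENNReal.half_pos hδ.ne')] with n hn
  have hcheb : P {ω | M ≤ |normSum P Z n ω|} ≤ δ / 2 := by
    have h := meas_ge_le_variance_div_sq (memLp_normSum hL n) hM
    simp only [integral_normSum hL hident n, sub_zero] at h
    refine h.trans (le_trans (ENNReal.ofReal_le_ofReal ?_) hMδ)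
    gcongr
    exact variance_normSum_le hL hindep hident n
  calc P {ω | ε ≤ ‖V n ω * normSum P Z n ω - 0‖}
      ≤ P ({ω | ε / M ≤ ‖V n ω - 0‖} ∪ {ω | M ≤ |normSum P Z n ω|}) := by
        refine measure_mono fun ω hω ↦ ?_
        simp only [sub_zero, Real.norm_eq_abs, abs_mul, Set.mem_ofPred_eq, Set.mem_union] at hω ⊢
        by_contra! hcon
        have h1 : |V n ω| * |normSum P Z n ω| < ε / M * M :=
          mul_lt_mul'' hcon.1 hcon.2 (abs_nonneg _) (abs_nonneg _)
        rw [div_mul_cancel₀ _ hM.ne'] at h1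
        exact absurd hω (not_le.2 h1)
    _ ≤ δ / 2 + δ / 2 := (measure_union_le _ _).trans (add_le_add hn hcheb)
    _ = δ := ENNReal.add_halves δ

/-! ### Sequences that are linear in the empirical moments -/

/-- The empirical moment of order `j` of the first `n` terms of `x`. -/
noncomputable def empMoment (x : ℕ → ℝ) (n j : ℕ) : ℝ :=
  (1 / (n : ℝ)) * ∑ i ∈ Finset.range n, x i ^ j

/-- The sequence of estimators `Y` is consistent for `θ`, and its error is a combination
`Y n - θ = ∑_{j ≤ d} W j n * (empMoment n j - moment j)` of the errors of the empirical moments of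
order at most `d`, with random coefficients `W j n` that converge almost surely to constants `w j`;
its influence function `φ` is the polynomial `∑_{j ≤ d} w j * x ^ j`.
The expansion is exact, so no remainder has to be controlled when such sequences are combined. -/
structure MomentLinear (P : Measure Ω) (G : Measure ℝ) (X : ℕ → Ω → ℝ) (d : ℕ)
    (Y : ℕ → Ω → ℝ) (θ : ℝ) (φ : ℝ → ℝ) : Prop where
  aemeasurable : ∀ n, AEMeasurable (Y n) P
  tendsto : ∀ᵐ ω ∂P, Tendsto (fun n ↦ Y n ω) atTop (𝓝 θ)
  expansion : ∃ (W : ℕ → ℕ → Ω → ℝ) (w : ℕ → ℝ),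
    (∀ j n, AEMeasurable (W j n) P) ∧
    (∀ j, ∀ᵐ ω ∂P, Tendsto (fun n ↦ W j n ω) atTop (𝓝 (w j))) ∧
    (∀ n ω, Y n ω - θ = ∑ j ∈ Finset.range (d + 1),
      W j n ω * (empMoment (fun i ↦ X i ω) n j - moment id j G)) ∧
    ∀ x, φ x = ∑ j ∈ Finset.range (d + 1), w j * x ^ j

namespace MomentLinear

variable {G : Measure ℝ} {X : ℕ → Ω → ℝ} {d : ℕ} {Y Z : ℕ → Ω → ℝ} {θ η : ℝ} {φ ψ : ℝ → ℝ}

lemma const (c : ℝ) : MomentLinear P G X d (fun _ _ ↦ c) c (fun _ ↦ 0) :=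
  ⟨fun _ ↦ aemeasurable_const, ae_of_all _ fun _ ↦ tendsto_const_nhds,
    fun _ _ _ ↦ 0, fun _ ↦ 0, fun _ _ ↦ aemeasurable_const,
    fun _ ↦ ae_of_all _ fun _ ↦ tendsto_const_nhds, by simp, by simp⟩

lemma add (hY : MomentLinear P G X d Y θ φ) (hZ : MomentLinear P G X d Z η ψ) :
    MomentLinear P G X d (fun n ω ↦ Y n ω + Z n ω) (θ + η) (fun x ↦ φ x + ψ x) := by
  obtain ⟨W, w, hWm, hWt, hWe, hφ⟩ := hY.expansion
  obtain ⟨V, v, hVm, hVt, hVe, hψ⟩ := hZ.expansion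
  refine ⟨fun n ↦ (hY.aemeasurable n).add (hZ.aemeasurable n), ?_,
    fun j n ω ↦ W j n ω + V j n ω, fun j ↦ w j + v j, fun j n ↦ (hWm j n).add (hVm j n),
    fun j ↦ ?_, fun n ω ↦ ?_, fun x ↦ ?_⟩
  · filter_upwards [hY.tendsto, hZ.tendsto] with ω h1 h2 using h1.add h2
  · filter_upwards [hWt j, hVt j] with ω h1 h2 using h1.add h2
  · simp only [add_mul, Finset.sum_add_distrib, ← hWe, ← hVe]
    ring
  · simp only [add_mul, Finset.sum_add_distrib, ← hφ, ← hψ]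

/-- The product rule, from `y z - θ η = z (y - θ) + θ (z - η)`. -/
lemma mul (hY : MomentLinear P G X d Y θ φ) (hZ : MomentLinear P G X d Z η ψ) :
    MomentLinear P G X d (fun n ω ↦ Y n ω * Z n ω) (θ * η) (fun x ↦ η * φ x + θ * ψ x) := by
  obtain ⟨W, w, hWm, hWt, hWe, hφ⟩ := hY.expansion
  obtain ⟨V, v, hVm, hVt, hVe, hψ⟩ := hZ.expansion
  refine ⟨fun n ↦ (hY.aemeasurable n).mul (hZ.aemeasurable n), ?_,
    fun j n ω ↦ Z n ω * W j n ω + θ * V j n ω, fun j ↦ η * w j + θ * v j,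
    fun j n ↦ ((hZ.aemeasurable n).mul (hWm j n)).add ((hVm j n).const_mul θ),
    fun j ↦ ?_, fun n ω ↦ ?_, fun x ↦ ?_⟩
  · filter_upwards [hY.tendsto, hZ.tendsto] with ω h1 h2 using h1.mul h2
  · filter_upwards [hZ.tendsto, hWt j, hVt j] with ω h h1 h2
      using (h.mul h1).add (h2.const_mul θ)
  · simp only [add_mul, Finset.sum_add_distrib, mul_assoc, ← Finset.mul_sum, ← hWe, ← hVe]
    ring
  · simp only [add_mul, Finset.sum_add_distrib, mul_assoc, ← Finset.mul_sum, ← hφ, ← hψ]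

lemma const_mul (c : ℝ) (hY : MomentLinear P G X d Y θ φ) :
    MomentLinear P G X d (fun n ω ↦ c * Y n ω) (c * θ) (fun x ↦ c * φ x) := by
  simpa using (const (P := P) (G := G) (X := X) (d := d) c).mul hY

lemma sum {ι : Type*} (s : Finset ι) {Y : ι → ℕ → Ω → ℝ} {θ : ι → ℝ} {φ : ι → ℝ → ℝ}
    (h : ∀ i ∈ s, MomentLinear P G X d (Y i) (θ i) (φ i)) :
    MomentLinear P G X d (fun n ω ↦ ∑ i ∈ s, Y i n ω) (∑ i ∈ s, θ i)
      (fun x ↦ ∑ i ∈ s, φ i x) := by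
  classical
  induction s using Finset.induction_on with
  | empty => simpa using const (P := P) (G := G) (X := X) (d := d) 0
  | insert a s ha ih =>
    simp only [Finset.sum_insert ha]
    exact (h a (Finset.mem_insert_self a s)).add
      (ih fun i hi ↦ h i (Finset.mem_insert_of_mem hi))

/-- The delta method: `F y - F θ = q y * (y - θ)`, where the slope `q` is continuous at `θ`, with
value `F' = q θ`. -/
lemma comp (hY : MomentLinear P G X d Y θ φ) {F : ℝ → ℝ} {F' : ℝ} (hF : Measurable F)
    (hF' : HasDerivAt F F' θ) :
    MomentLinear P G X d (fun n ω ↦ F (Y n ω)) (F θ) (fun x ↦ F' * φ x) := by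
  obtain ⟨W, w, hWm, hWt, hWe, hφ⟩ := hY.expansion
  have hq : Measurable (dslope F θ) := by
    classical
    have h : dslope F θ = fun y ↦ if y = θ then deriv F θ else (F y - F θ) / (y - θ) := by
      ext y
      split_ifs with hy
      · rw [hy, dslope_same]
      · rw [dslope_of_ne _ hy, slope_def_field]
    rw [h]
    exact Measurable.ite (measurableSet_singleton θ) measurable_const (by fun_prop)
  have hqt : Tendsto (dslope F θ) (𝓝 θ) (𝓝 F') := by
    have h := continuousAt_dslope_same.2 hF'.differentiableAt
    rwa [ContinuousAt, dslope_same, hF'.deriv] at h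
  refine ⟨fun n ↦ hF.comp_aemeasurable (hY.aemeasurable n), ?_,
    fun j n ω ↦ dslope F θ (Y n ω) * W j n ω, fun j ↦ F' * w j,
    fun j n ↦ (hq.comp_aemeasurable (hY.aemeasurable n)).mul (hWm j n),
    fun j ↦ ?_, fun n ω ↦ ?_, fun x ↦ ?_⟩
  · filter_upwards [hY.tendsto] with ω h using hF'.continuousAt.tendsto.comp h
  · filter_upwards [hY.tendsto, hWt j] with ω h h1 using (hqt.comp h).mul h1
  · simp only [mul_assoc, ← Finset.mul_sum, ← hWe]
    rw [mul_comm, ← smul_eq_mul, sub_smul_dslope]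
  · simp only [mul_assoc, ← Finset.mul_sum, ← hφ]

lemma eq_influence (hY : MomentLinear P G X d Y θ φ) (hη : θ = η) (h : ∀ x, φ x = ψ x) :
    MomentLinear P G X d Y η ψ := by
  rwa [← hη, ← funext h]

end MomentLinear

lemma MomentLinear.memLp {G : Measure ℝ} {X Y : ℕ → Ω → ℝ} {d : ℕ} {θ : ℝ} {φ : ℝ → ℝ}
    (hY : MomentLinear P G X d Y θ φ) (hL : ∀ j ≤ d, MemLp (fun x : ℝ ↦ x ^ j) 2 G) :
    MemLp φ 2 G := by
  obtain ⟨_, w, -, -, -, hφ⟩ := hY.expansion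
  rw [funext hφ]
  exact memLp_finsetSum _ fun j hj ↦
    (hL j (Nat.lt_succ_iff.1 (Finset.mem_range.1 hj))).const_mul _

/-! ### Consistency and asymptotic normality -/

section Limit

variable {G : Measure ℝ} {X : ℕ → Ω → ℝ} {d : ℕ}

lemma moment_eq_integral (j : ℕ) : moment id j G = ∫ x, x ^ j ∂G := by
  simp [moment]

/-- The strong law of large numbers for the empirical moments. -/
lemma momentLinear_empMoment (hindep : iIndepFun X P) (hlaw : ∀ i, HasLaw (X i) G P) {j : ℕ}
    (hj : j ≤ d) (hint : Integrable (fun x : ℝ ↦ x ^ j) G) :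
    MomentLinear P G X d (fun n ω ↦ empMoment (fun i ↦ X i ω) n j) (moment id j G)
      (fun x ↦ x ^ j) := by
  have hm : ∀ i, AEMeasurable (X i) P := fun i ↦ (hlaw i).aemeasurable
  have hpow : Measurable fun x : ℝ ↦ x ^ j := by fun_prop
  refine ⟨fun n ↦ ?_, ?_, fun i _ _ ↦ if i = j then 1 else 0, fun i ↦ if i = j then 1 else 0,
    fun _ _ ↦ aemeasurable_const, fun _ ↦ ae_of_all _ fun _ ↦ tendsto_const_nhds, ?_, ?_⟩
  · exact (Finset.aemeasurable_fun_sum _ fun i _ ↦ (hm i).pow_const j).const_mul _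
  · have hX0 : Integrable (fun ω ↦ X 0 ω ^ j) P := by
      rw [← (hlaw 0).map_eq] at hint
      exact hint.comp_aemeasurable (hm 0)
    have h := strong_law_ae_real (μ := P) (fun i ω ↦ X i ω ^ j) hX0
      (fun i i' hii' ↦ (hindep.comp (fun _ x ↦ x ^ j) fun _ ↦ hpow).indepFun hii')
      (fun i ↦ ((hlaw i).identDistrib (hlaw 0)).comp hpow)
    have h0 : ∫ ω, X 0 ω ^ j ∂P = moment id j G := by
      rw [moment_eq_integral]
      exact (hlaw 0).integral_comp (f := fun x ↦ x ^ j) hpow.aestronglyMeasurable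
    filter_upwards [h] with ω hω
    simpa only [empMoment, h0, one_div, inv_mul_eq_div] using hω
  · intro n ω
    simp [Finset.sum_ite_eq', Nat.lt_succ_of_le hj]
  · intro x
    simp [Finset.sum_ite_eq', Nat.lt_succ_of_le hj]

/-- Replacing the random coefficients of the expansion by their limits changes `√n (Y n - θ)` by a
sequence that tends to `0` in probability and leaves the normalized sum of the `φ (X i)`, to which
the central limit theorem applies. -/
lemma MomentLinear.tendstoInDistribution [IsProbabilityMeasure P] {Y : ℕ → Ω → ℝ} {θ : ℝ} {φ : ℝ → ℝ}
    (hY : MomentLinear P G X d Y θ φ)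
    (hindep : iIndepFun X P) (hlaw : ∀ i, HasLaw (X i) G P)
    (hL : ∀ j ≤ d, MemLp (fun x : ℝ ↦ x ^ j) 2 G) :
    TendstoInDistribution (fun (n : ℕ) ω ↦ √(n : ℝ) * (Y n ω - θ)) atTop (id : ℝ → ℝ)
      (fun _ ↦ P) (gaussianReal 0 Var[φ; G].toNNReal) := by
  obtain ⟨W, w, hWm, hWt, hWe, hφ⟩ := hY.expansion
  have hm : ∀ i, AEMeasurable (X i) P := fun i ↦ (hlaw i).aemeasurable
  have : IsProbabilityMeasure G := (hlaw 0).isProbabilityMeasure_iff.1 inferInstance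
  have hφm : Measurable φ := by
    rw [funext hφ]
    fun_prop
  have hφL : MemLp φ 2 G := hY.memLp hL
  have hcompL : ∀ {h : ℝ → ℝ}, Measurable h → MemLp h 2 G → ∀ i, MemLp (fun ω ↦ h (X i ω)) 2 P := by
    intro h hh hhL i
    rw [← (hlaw i).map_eq] at hhL
    exact hhL.comp_of_map (hm i)
  have hind : ∀ {h : ℝ → ℝ}, Measurable h → iIndepFun (fun i ω ↦ h (X i ω)) P :=
    fun {h} hh ↦ hindep.comp (fun _ ↦ h) fun _ ↦ hh
  have hid : ∀ {h : ℝ → ℝ}, Measurable h →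
      ∀ i, IdentDistrib (fun ω ↦ h (X i ω)) (fun ω ↦ h (X 0 ω)) P P :=
    fun hh i ↦ ((hlaw i).identDistrib (hlaw 0)).comp hh
  have hexp : ∀ {h : ℝ → ℝ}, Measurable h → ∫ ω, h (X 0 ω) ∂P = ∫ x, h x ∂G :=
    fun {h} hh ↦ (hlaw 0).integral_comp (f := h) hh.aestronglyMeasurable
  have hvar : Var[fun ω ↦ φ (X 0 ω); P] = Var[φ; G] := by
    rw [← (hlaw 0).map_eq, variance_map hφm.aemeasurable (hm 0)]
    rfl
  have hpow : ∀ j : ℕ, Measurable fun x : ℝ ↦ x ^ j := fun j ↦ by fun_prop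
  have hclt : TendstoInDistribution (normSum P fun i ω ↦ φ (X i ω)) atTop (id : ℝ → ℝ)
      (fun _ ↦ P) (gaussianReal 0 Var[φ; G].toNNReal) := by
    refine tendstoInDistribution_inv_sqrt_mul_sum_sub ?_ (hcompL hφm hφL 0) (hind hφm) (hid hφm)
    rw [hvar]
    exact HasLaw.id
  -- the errors of the empirical moments are normalized sums
  have hmom : ∀ (j n : ℕ) (ω : Ω), normSum P (fun i ω ↦ X i ω ^ j) n ω =
      √(n : ℝ) * (empMoment (fun i ↦ X i ω) n j - moment id j G) := by
    intro j n ω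
    rcases eq_or_ne n 0 with rfl | hn
    · simp [normSum]
    have hs : √(n : ℝ) ≠ 0 := (Real.sqrt_pos.2 (by positivity)).ne'
    have hn' : (n : ℝ) = √(n : ℝ) * √(n : ℝ) := (Real.mul_self_sqrt n.cast_nonneg).symm
    rw [normSum, hexp (hpow j), moment_eq_integral, empMoment]
    generalize ∑ i ∈ Finset.range n, X i ω ^ j = S
    generalize ∫ x, x ^ j ∂G = m
    field_simp
    rw [sq, ← hn']
  have hsplit : ∀ (n : ℕ) (ω : Ω), normSum P (fun i ω ↦ φ (X i ω)) n ω =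
      ∑ j ∈ Finset.range (d + 1), w j * normSum P (fun i ω ↦ X i ω ^ j) n ω := by
    intro n ω
    have h1 : ∫ x, φ x ∂G = ∑ j ∈ Finset.range (d + 1), w j * ∫ x, x ^ j ∂G := by
      simp only [hφ]
      rw [integral_finsetSum]
      · simp only [integral_const_mul]
      · exact fun j hj ↦ ((hL j (Nat.lt_succ_iff.1 (Finset.mem_range.1 hj))).integrable
          one_le_two).const_mul _
    simp only [normSum]
    rw [hexp hφm, h1]
    simp only [hφ, hexp (hpow _)]
    rw [Finset.sum_comm]
    simp only [mul_sub, Finset.sum_sub_distrib, Finset.mul_sum]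
    congr 1
    · refine Finset.sum_congr rfl fun j _ ↦ Finset.sum_congr rfl fun i _ ↦ by ring
    · refine Finset.sum_congr rfl fun j _ ↦ by ring
  -- add the errors of the coefficients one index at a time
  have hall : ∀ s ⊆ Finset.range (d + 1), TendstoInDistribution
      (fun n ω ↦ normSum P (fun i ω ↦ φ (X i ω)) n ω +
        ∑ j ∈ s, (W j n ω - w j) * normSum P (fun i ω ↦ X i ω ^ j) n ω) atTop (id : ℝ → ℝ)
      (fun _ ↦ P) (gaussianReal 0 Var[φ; G].toNNReal) := by
    intro s
    induction s using Finset.induction_on with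
    | empty =>
      intro _
      simpa using hclt
    | insert a s ha ih =>
      intro hs
      have haL := hL a (Nat.lt_succ_iff.1 (Finset.mem_range.1 (hs (Finset.mem_insert_self a s))))
      have hVm : ∀ n, AEMeasurable (fun ω ↦ W a n ω - w a) P := fun n ↦ (hWm a n).sub_const _
      have h := (ih ((Finset.subset_insert a s).trans hs)).add_of_tendstoInMeasure_const
        (tendstoInMeasure_mul_normSum (hcompL (hpow a) haL) (hind (hpow a)) (hid (hpow a)) hVm
          (by filter_upwards [hWt a] with ω hω using by simpa using hω.sub_const (w a)))
        (fun n ↦ (hVm n).mul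
          (memLp_normSum (hcompL (hpow a) haL) n).aestronglyMeasurable.aemeasurable)
      simp only [add_zero] at h
      convert! h using 3 with n ω
      simp only [Finset.sum_insert ha, Pi.add_apply]
      ring
  convert! hall _ subset_rfl using 3 with n ω
  rw [hWe, Finset.mul_sum, hsplit, ← Finset.sum_add_distrib]
  refine Finset.sum_congr rfl fun j _ ↦ ?_
  rw [hmom]
  ring

end Limit

/-! ### Central moments -/

variable {G : Measure ℝ} {X : ℕ → Ω → ℝ}

lemma empCentralMoment_eq_sum (x : ℕ → ℝ) (n l : ℕ) :
    empCentralMoment x n l = ∑ p ∈ Finset.range (l + 1),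
      (l.choose p : ℝ) * ((-empMoment x n 1) ^ (l - p) * empMoment x n p) := by
  have h : empMean x n = empMoment x n 1 := by simp [empMean, empMoment]
  simp only [empCentralMoment, h, sub_eq_add_neg, add_pow]
  generalize -empMoment x n 1 = c
  rw [Finset.sum_comm, Finset.mul_sum]
  refine Finset.sum_congr rfl fun p _ ↦ ?_
  simp only [empMoment, Finset.mul_sum]
  exact Finset.sum_congr rfl fun i _ ↦ by ring

lemma centralMoment_eq_sum {l : ℕ} (hint : ∀ p ≤ l, Integrable (fun x : ℝ ↦ x ^ p) G) :
    centralMoment id l G = ∑ p ∈ Finset.range (l + 1),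
      (l.choose p : ℝ) * ((-moment id 1 G) ^ (l - p) * moment id p G) := by
  have h : centralMoment id l G = ∫ x, (x - moment id 1 G) ^ l ∂G := by
    simp [centralMoment, moment]
  rw [h]
  generalize moment id 1 G = m
  simp only [sub_eq_add_neg, add_pow]
  rw [integral_finsetSum]
  · refine Finset.sum_congr rfl fun p _ ↦ ?_
    rw [moment_eq_integral, ← integral_const_mul, ← integral_const_mul]
    exact integral_congr_ae (ae_of_all _ fun x ↦ by ring)
  · exact fun p hp ↦ ((hint p (Nat.lt_succ_iff.1 (Finset.mem_range.1 hp))).mul_const _).mul_const _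

lemma momentLinear_empCentralMoment (hindep : iIndepFun X P) (hlaw : ∀ i, HasLaw (X i) G P)
    {d l : ℕ} (hd : 1 ≤ d) (hl : l ≤ d) (hint : ∀ p ≤ d, Integrable (fun x : ℝ ↦ x ^ p) G) :
    MomentLinear P G X d (fun n ω ↦ empCentralMoment (fun i ↦ X i ω) n l) (centralMoment id l G)
      (APoly G l) := by
  simp only [empCentralMoment_eq_sum]
  rw [centralMoment_eq_sum fun p hp ↦ hint p (hp.trans hl)]
  have hM : ∀ p ≤ d, MomentLinear P G X d (fun n ω ↦ empMoment (fun i ↦ X i ω) n p)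
      (moment id p G) (fun x ↦ x ^ p) := fun p hp ↦
    momentLinear_empMoment hindep hlaw hp (hint p hp)
  have hder : ∀ q : ℕ, HasDerivAt (fun y : ℝ ↦ (-y) ^ q)
      (q * (-moment id 1 G) ^ (q - 1) * -1) (moment id 1 G) := fun q ↦
    (hasDerivAt_neg _).fun_pow q
  refine (MomentLinear.sum (Finset.range (l + 1)) fun p hp ↦
    (((hM 1 hd).comp (F := fun y ↦ (-y) ^ (l - p)) (by fun_prop) (hder (l - p))).mul
      (hM p ((Nat.lt_succ_iff.1 (Finset.mem_range.1 hp)).trans hl))).const_mul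
        (l.choose p : ℝ)).eq_influence rfl fun x ↦ ?_
  rw [Finset.sum_range_succ, APoly, add_comm]
  congr 1
  · simp
  · refine Finset.sum_congr rfl fun p hp ↦ ?_
    obtain ⟨q, hq⟩ : ∃ q, l - p = q + 1 := ⟨l - p - 1, by have := Finset.mem_range.1 hp; omega⟩
    rw [hq, Nat.add_sub_cancel, neg_pow (moment id 1 G), neg_pow (moment id 1 G) (q + 1)]
    ring

/-! ### Normalized central moments -/

lemma sigma_sq : sigma G ^ 2 = centralMoment id 2 G := by
  rw [sigma, Real.sq_sqrt (variance_nonneg _ _), centralMoment_two_eq_variance aemeasurable_id]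

lemma sigma_pos (h : 0 < Var[id; G]) : 0 < sigma G := Real.sqrt_pos.2 h

lemma momentLinear_bEmp {d p : ℕ} (hp : 1 ≤ p) (hpos : 0 < sigma G)
    (h2 : MomentLinear P G X d (fun n ω ↦ empCentralMoment (fun i ↦ X i ω) n 2) (sigma G ^ 2)
      (APoly G 2))
    (hodd : MomentLinear P G X d (fun n ω ↦ empCentralMoment (fun i ↦ X i ω) n (2 * p - 1))
      (centralMoment id (2 * p - 1) G) (APoly G (2 * p - 1))) :
    MomentLinear P G X d (fun n ω ↦ bEmp (fun i ↦ X i ω) n p) (bTh G p) (BPoly G p) := by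
  set r : ℝ := (2 * (p : ℝ) - 1) / 2 with hr
  have hs : (sigma G ^ 2) ^ r = sigma G ^ (2 * p - 1) := by
    rw [← Real.rpow_natCast (sigma G) 2, ← Real.rpow_mul hpos.le,
      ← Real.rpow_natCast (sigma G) (2 * p - 1)]
    congr 1
    rw [Nat.cast_sub (by omega), hr]
    push_cast
    ring
  have hder : HasDerivAt (fun y : ℝ ↦ (y ^ r)⁻¹)
      (-(r * (sigma G ^ 2) ^ (r - 1)) / ((sigma G ^ 2) ^ r) ^ 2) (sigma G ^ 2) :=
    (Real.hasDerivAt_rpow_const (Or.inl (by positivity))).fun_inv (by positivity)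
  refine (hodd.mul (h2.comp (by fun_prop) hder)).eq_influence ?_ fun x ↦ ?_
  · rw [hs, bTh, div_eq_mul_inv]
  · rw [Real.rpow_sub_one (by positivity), hs, BPoly, hr]
    field_simp
    ring

lemma momentLinear_aEmp {d p : ℕ} (hpos : 0 < sigma G)
    (h2 : MomentLinear P G X d (fun n ω ↦ empCentralMoment (fun i ↦ X i ω) n 2) (sigma G ^ 2)
      (APoly G 2))
    (heven : MomentLinear P G X d (fun n ω ↦ empCentralMoment (fun i ↦ X i ω) n (2 * p))
      (centralMoment id (2 * p) G) (APoly G (2 * p))) :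
    MomentLinear P G X d (fun n ω ↦ aEmp (fun i ↦ X i ω) n p) (aTh G p) (CPoly G p) := by
  have hder : HasDerivAt (fun y : ℝ ↦ (y ^ p)⁻¹)
      (-(p * (sigma G ^ 2) ^ (p - 1)) / ((sigma G ^ 2) ^ p) ^ 2) (sigma G ^ 2) :=
    (hasDerivAt_pow p (sigma G ^ 2)).fun_inv (by positivity)
  refine (heven.mul (h2.comp (by fun_prop) hder)).eq_influence ?_ fun x ↦ ?_
  · rw [← pow_mul, aTh, div_eq_mul_inv]
  · rcases p with _ | p
    · simp [CPoly]
    rw [Nat.add_sub_cancel, CPoly, ← pow_mul, ← pow_mul, show 2 * (p + 1) = 2 * p + 2 by ring]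
    field_simp
    ring

lemma momentLinear_TEmp (hindep : iIndepFun X P) (hlaw : ∀ i, HasLaw (X i) G P) {k : ℕ}
    (hk : 1 ≤ k) (hint : ∀ p ≤ 2 * k, Integrable (fun x : ℝ ↦ x ^ p) G) (hnondeg : 0 < Var[id; G])
    {f g : ℕ → ℝ → ℝ} (hf : ∀ p, 2 ≤ p → p ≤ k → ContDiff ℝ 1 (f p))
    (hg : ∀ p, 2 ≤ p → p ≤ k → ContDiff ℝ 1 (g p)) :
    MomentLinear P G X (2 * k) (fun n ω ↦ TEmp f g k (fun i ↦ X i ω) n) (TTh f g k G)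
      (DPoly f g k G) := by
  have hpos := sigma_pos hnondeg
  have hc : ∀ l ≤ 2 * k, MomentLinear P G X (2 * k)
      (fun n ω ↦ empCentralMoment (fun i ↦ X i ω) n l) (centralMoment id l G) (APoly G l) :=
    fun l hl ↦ momentLinear_empCentralMoment hindep hlaw (by omega) hl hint
  have h2 := hc 2 (by omega)
  rw [← sigma_sq] at h2
  have hderiv : ∀ {F : ℝ → ℝ}, ContDiff ℝ 1 F → ∀ y, HasDerivAt F (deriv F y) y :=
    fun hF y ↦ (hF.differentiable one_ne_zero y).hasDerivAt
  refine MomentLinear.sum _ fun p hp ↦ ?_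
  obtain ⟨hp2, hpk⟩ := Finset.mem_Icc.1 hp
  have hfp := hf p hp2 hpk
  have hgp := hg p hp2 hpk
  exact ((momentLinear_bEmp (by omega) hpos h2 (hc _ (by omega))).comp
    hfp.continuous.measurable (hderiv hfp _)).add
    ((momentLinear_aEmp hpos h2 (hc _ (by omega))).comp hgp.continuous.measurable (hderiv hgp _))

lemma memLp_pow_two_of_integrable_abs_pow [IsFiniteMeasure G] {d : ℕ}
    (h : Integrable (fun x : ℝ ↦ |x| ^ (2 * d)) G) {j : ℕ} (hj : j ≤ d) :
    MemLp (fun x : ℝ ↦ x ^ j) 2 G := by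
  rw [memLp_two_iff_integrable_sq (by fun_prop)]
  refine ((integrable_const (1 : ℝ)).add h).mono' (by fun_prop) (ae_of_all _ fun x ↦ ?_)
  rw [Real.norm_eq_abs, abs_pow, abs_pow, ← pow_mul, Pi.add_apply]
  rcases le_total |x| 1 with hx | hx
  · exact (pow_le_one₀ (abs_nonneg x) hx).trans (le_add_of_nonneg_right (by positivity))
  · exact (pow_le_pow_right₀ hx (by omega)).trans (le_add_of_nonneg_left zero_le_one)

end NCEM

/-! ### Asymptotic normality of the statistic -/

theorem theorem1 {Ω : Type*} [MeasurableSpace Ω] (P : Measure Ω) [IsProbabilityMeasure P]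
    (G : Measure ℝ) (X : ℕ → Ω → ℝ)
    (hindep : iIndepFun X P) (hlaw : ∀ i, HasLaw (X i) G P)
    (k : ℕ) (hk : 2 ≤ k)
    (hmoment : Integrable (fun x : ℝ => |x| ^ (4 * k)) G)
    (hnondeg : 0 < Var[id; G])
    (f g : ℕ → ℝ → ℝ)
    (hf : ∀ p, 2 ≤ p → p ≤ k → ContDiff ℝ 1 (f p))
    (hg : ∀ p, 2 ≤ p → p ≤ k → ContDiff ℝ 1 (g p)) :
    Integrable (NCEM.DPoly f g k G) G ∧
    Integrable (fun x => NCEM.DPoly f g k G x ^ 2) G ∧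
    ∃ v : ℝ≥0,
      (v : ℝ) = (∫ x, NCEM.DPoly f g k G x ^ 2 ∂G) - (∫ x, NCEM.DPoly f g k G x ∂G) ^ 2 ∧
      (v : ℝ) = Var[NCEM.DPoly f g k G; G] ∧
      TendstoInDistribution
        (fun (n : ℕ) (ω : Ω) =>
          √(n : ℝ) * (NCEM.TEmp f g k (fun i => X i ω) n - NCEM.TTh f g k G))
        atTop (id : ℝ → ℝ) (fun _ => P) (gaussianReal 0 v) := by
  have hG : IsProbabilityMeasure G := (hlaw 0).isProbabilityMeasure_iff.1 inferInstance
  have hL : ∀ j ≤ 2 * k, MemLp (fun x : ℝ ↦ x ^ j) 2 G := fun j hj ↦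
    NCEM.memLp_pow_two_of_integrable_abs_pow (by simpa [← mul_assoc] using hmoment) hj
  have hT := NCEM.momentLinear_TEmp hindep hlaw (by omega)
    (fun p hp ↦ (hL p hp).integrable one_le_two) hnondeg hf hg
  have hD : MemLp (NCEM.DPoly f g k G) 2 G := hT.memLp hL
  have hv : ((Var[NCEM.DPoly f g k G; G].toNNReal : ℝ≥0) : ℝ) = Var[NCEM.DPoly f g k G; G] :=
    Real.coe_toNNReal _ (variance_nonneg _ _)
  refine ⟨hD.integrable one_le_two, hD.integrable_sq, _, ?_, hv,
    hT.tendstoInDistribution hindep hlaw hL⟩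
  rw [hv, variance_eq_sub hD]
  rfl
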